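/- **Proposition 3.3.** Let $n\ge 5$ and let $P$ be a convex $n$-gon. Let $\mathcal{A}_n$ be the associahedron graph: its vertices are the triangulations of $P$, i.e. the sets of $n-3$ pairwise non-crossing diagonals of $P$, and two distinct triangulations are adjacent if they share exactly $n-4$ diagonals. If $T$ and $T'$ are adjacent vertices of $\mathcal{A}_n$, then the edge $TT'$ is contained in at least one and at most four cycles of length $5$ in $\mathcal{A}_n$ (cycles being counted as subgraphs isomorphic to $C_5$). More precisely, $T\setminus T'=\{d\}$ and $T'\setminus T=\{d'\}$ for two crossing diagonals $d,d'$, which are the diagonals of a quadrilateral $F$. A side of $F$ belongs to $T\cap T'$ if and only if it is not a side of $P$, and there is a bijection between the $5$-cycles of $\mathcal{A}_n$ containing the edge $TT'$ and the sides $s$ of $F$ that are not sides of $P$, under which the vertex set of the $5$-cycle corresponding to $s$ is the set of all triangulations containing $(T\cap T')\setminus\{s\}$. -/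

import Mathlib

/-! Vertices of a convex `n`-gon are labelled by `Fin n` in cyclic order.  A segment joining two
distinct vertices `i < j` is the pair `(i, j)`. -/

/-- The segment `s = (i, j)`, `i < j`, is a side of the convex `n`-gon: its endpoints are
consecutive, or they are the first and the last vertex. -/
def PolygonSide {n : ℕ} (s : Fin n × Fin n) : Prop :=
  s.1 < s.2 ∧ ((s.1 : ℕ) + 1 = (s.2 : ℕ) ∨ ((s.1 : ℕ) = 0 ∧ (s.2 : ℕ) + 1 = n))

/-- A diagonal of the convex `n`-gon: a segment joining two distinct vertices which is not a
side. -/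
def PolygonDiagonal {n : ℕ} (s : Fin n × Fin n) : Prop :=
  s.1 < s.2 ∧ ¬ PolygonSide s

/-- Two segments (written with increasing endpoints) cross in the interior of the polygon: their
endpoints are four distinct vertices that alternate around the polygon. -/
def SegmentsCross {n : ℕ} (s t : Fin n × Fin n) : Prop :=
  (s.1 < t.1 ∧ t.1 < s.2 ∧ s.2 < t.2) ∨ (t.1 < s.1 ∧ s.1 < t.2 ∧ t.2 < s.2)

/-- A set of `n - 3` pairwise non-crossing diagonals of the convex `n`-gon. -/
structure IsTriangulation {n : ℕ} (T : Finset (Fin n × Fin n)) : Prop where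
  diagonal : ∀ s ∈ T, PolygonDiagonal s
  noncrossing : ∀ s ∈ T, ∀ t ∈ T, ¬ SegmentsCross s t
  card_add_three : T.card + 3 = n

/-- The triangulations of the convex `n`-gon. -/
abbrev PolygonTriangulation (n : ℕ) : Type :=
  {T : Finset (Fin n × Fin n) // IsTriangulation T}

/-- The associahedron graph (flip graph): two distinct triangulations are adjacent when they share
`n - 4` diagonals. -/
def associahedronGraph (n : ℕ) : SimpleGraph (PolygonTriangulation n) where
  Adj T T' := T ≠ T' ∧ (T.1 ∩ T'.1).card + 4 = n
  symm := ⟨fun T T' h => ⟨h.1.symm, by rw [Finset.inter_comm]; exact h.2⟩⟩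
  loopless := ⟨fun _ h => h.1 rfl⟩

/-- The cycles of length five of `G` (subgraphs isomorphic to the 5-cycle) that contain the edge
joining `u` and `v`. -/
def fiveCyclesThrough {V : Type*} (G : SimpleGraph V) (u v : V) : Set G.Subgraph :=
  {C | Nonempty (C.coe ≃g SimpleGraph.cycleGraph 5) ∧ C.Adj u v}

/-- The sides of the quadrilateral whose two diagonals are the crossing segments `d` and `d'`: the
segments joining an endpoint of `d` to an endpoint of `d'`. -/
def quadrilateralSides {n : ℕ} (d d' : Fin n × Fin n) : Finset (Fin n × Fin n) :=
  {s | s.1 < s.2 ∧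
    (((s.1 = d.1 ∨ s.1 = d.2) ∧ (s.2 = d'.1 ∨ s.2 = d'.2)) ∨
     ((s.1 = d'.1 ∨ s.1 = d'.2) ∧ (s.2 = d.1 ∨ s.2 = d.2)))}

/-! At most `n - 3` diagonals are pairwise non-crossing, so triangulations are maximal non-crossing
sets. Hence adjacent triangulations differ by a flip inside a quadrilateral `F` whose sides are
edges of both. If a side `s` of `F` is a diagonal, deleting it from `T ∩ T'` merges `F` with the
triangle beyond `s` into a pentagon (`IsFlip.exists_isPentagon`). The five triangulations of this
pentagon form a 5-cycle through `TT'`. Conversely, follow a 5-cycle from `TT'`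
(`IsFlip.exists_side_of_five_cycle`). The flips leaving `T` and `T'` must remove the same diagonal
`x`, since the other two flips on the cycle cannot repair more. All five triangulations then contain
`(T ∩ T') \ {x}`. Were `x` not a side of `F`, the two flips would commute and close a triangle, but
the flip graph has none. Triangle-freeness also makes a 5-cycle recoverable from its vertex set, so
cycles match sides. There are at most four sides, and `n ≥ 5` prevents all of them from lying on the
polygon. -/

theorem PolygonSide.not_cross {n : ℕ} {s t : Fin n × Fin n} (hs : PolygonSide s) :
    ¬ SegmentsCross s t := by
  obtain ⟨i, j⟩ := s
  obtain ⟨k, l⟩ := t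
  simp only [PolygonSide, SegmentsCross, Fin.lt_def] at *
  omega

theorem SegmentsCross.symm {n : ℕ} {s t : Fin n × Fin n} (h : SegmentsCross s t) :
    SegmentsCross t s := Or.symm h

theorem PolygonDiagonal.gap {n : ℕ} {s : Fin n × Fin n} (hs : PolygonDiagonal s) :
    (s.1 : ℕ) + 1 < s.2 := by
  obtain ⟨i, j⟩ := s
  simp only [PolygonDiagonal, PolygonSide, Fin.lt_def] at *
  omega

/-! ### Size of non-crossing families and maximality of triangulations -/

/-- Among the vertices joined to `i` and lying before `j` there is a last one. -/
theorem exists_last_neighbor {n : ℕ} (E : Finset (Fin n × Fin n)) (i j : Fin n)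
    (hij : (i : ℕ) + 1 < j) :
    ∃ k : Fin n, i < k ∧ k < j ∧ ((k : ℕ) = i + 1 ∨ (i, k) ∈ E) ∧
      ∀ m : Fin n, k < m → m < j → (i, m) ∉ E := by
  classical
  let S : Finset (Fin n) := Finset.univ.filter fun k =>
    i < k ∧ k < j ∧ ((k : ℕ) = i + 1 ∨ (i, k) ∈ E)
  have hS : S.Nonempty := ⟨⟨i + 1, by omega⟩, by
    simp only [S, Finset.mem_filter, Finset.mem_univ, true_and, Fin.lt_def]
    exact ⟨by omega, by omega, Or.inl trivial⟩⟩
  obtain ⟨k, hk, hmax⟩ := S.exists_max_image id hS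
  simp only [S, Finset.mem_filter, Finset.mem_univ, true_and] at hk hmax
  refine ⟨k, hk.1, hk.2.1, hk.2.2, fun m hkm hmj hm => ?_⟩
  exact absurd (hmax m ⟨hk.1.trans hkm, hmj, Or.inr hm⟩) (not_le.mpr hkm)

/-- Send `(i, j)` to its apex, the last neighbour of `i` before `j`. Two segments with the same apex
`k` are nested, as both span `k`. If they share `i`, the shorter one contradicts the choice of `k`;
otherwise the edge from the outer left end to `k` crosses the inner segment. So the apex map is
injective into the `n - 2` vertices other than the first and last. -/
theorem card_add_two_le_of_noncrossing {n : ℕ} {E : Finset (Fin n × Fin n)}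
    (hn : 2 ≤ n) (hgap : ∀ s ∈ E, (s.1 : ℕ) + 1 < s.2)
    (hE : ∀ s ∈ E, ∀ t ∈ E, ¬ SegmentsCross s t) : E.card + 2 ≤ n := by
  have key : ∀ s : Fin n × Fin n, ∃ k : Fin n, s ∈ E → s.1 < k ∧ k < s.2 ∧
      ((k : ℕ) = s.1 + 1 ∨ (s.1, k) ∈ E) ∧ ∀ m : Fin n, k < m → m < s.2 → (s.1, m) ∉ E := by
    intro s
    by_cases hs : s ∈ E
    · obtain ⟨k, hk⟩ := exists_last_neighbor E s.1 s.2 (hgap s hs)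
      exact ⟨k, fun _ => hk⟩
    · exact ⟨s.1, fun h => absurd h hs⟩
  choose apex hapex using key
  have aux : ∀ s ∈ E, ∀ t ∈ E, apex s = apex t → s.1 ≤ t.1 → t.2 ≤ s.2 → s = t := by
    rintro ⟨i, j⟩ hs ⟨i', j'⟩ ht hst h1 h2
    have hs' := hapex _ hs
    have ht' := hapex _ ht
    rw [hst] at hs'
    set k := apex (i', j')
    simp only at *
    obtain ⟨a1, a2, a3, a4⟩ := hs'
    obtain ⟨b1, b2, b3, b4⟩ := ht'
    rcases h1.eq_or_lt with rfl | h1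
    · rcases h2.eq_or_lt with rfl | h2
      · rfl
      · exact absurd ht (a4 _ b2 h2)
    · rcases a3 with a3 | a3
      · simp only [Fin.lt_def] at *; omega
      · exact absurd (Or.inl ⟨h1, b1, b2⟩) (hE _ a3 _ ht)
  have hinj : Set.InjOn (fun s => ((apex s : Fin n) : ℕ)) (E : Set (Fin n × Fin n)) := by
    intro s hs t ht hst
    have hst : apex s = apex t := Fin.ext hst
    have hs' := hapex _ hs
    have ht' := hapex _ ht
    have c := hE s hs t ht
    have : (s.1 ≤ t.1 ∧ t.2 ≤ s.2) ∨ (t.1 ≤ s.1 ∧ s.2 ≤ t.2) := by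
      rw [hst] at hs'
      simp only [SegmentsCross, Fin.lt_def, Fin.le_def] at *
      omega
    rcases this with h | h
    · exact aux s hs t ht hst h.1 h.2
    · exact (aux t ht s hs hst.symm h.1 h.2).symm
  have hle := Finset.card_le_card_of_injOn (t := Finset.Ioo 0 (n - 1)) _ (fun s hs => by
    have hs' := hapex s hs
    have := s.2.isLt
    simp only [Fin.lt_def] at hs'
    simp only [Finset.coe_Ioo, Set.mem_Ioo]
    omega) hinj
  rw [Nat.card_Ioo] at hle
  omega

/-- The closing side from the first to the last vertex can be added to the family; it accounts for
the improvement by one. -/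
theorem card_add_three_le_of_noncrossing {n : ℕ} (hn : 3 ≤ n) {D : Finset (Fin n × Fin n)}
    (hdiag : ∀ s ∈ D, PolygonDiagonal s)
    (hD : ∀ s ∈ D, ∀ t ∈ D, ¬ SegmentsCross s t) : D.card + 3 ≤ n := by
  classical
  let o : Fin n × Fin n := (⟨0, by omega⟩, ⟨n - 1, by omega⟩)
  have ho : PolygonSide o := by
    refine ⟨?_, Or.inr ⟨rfl, ?_⟩⟩ <;> simp only [o, Fin.lt_def] <;> omega
  have hoD : o ∉ D := fun h => (hdiag o h).2 ho
  have := card_add_two_le_of_noncrossing (E := insert o D) (by omega) (by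
    intro s hs
    rcases Finset.mem_insert.mp hs with rfl | hs
    · simp only [o]; omega
    · exact (hdiag s hs).gap) (by
    intro s hs t ht
    rcases Finset.mem_insert.mp hs with rfl | hs
    · exact ho.not_cross
    rcases Finset.mem_insert.mp ht with rfl | ht
    · exact fun h => ho.not_cross h.symm
    · exact hD s hs t ht)
  rw [Finset.card_insert_of_notMem hoD] at this
  omega

theorem not_segmentsCross_self {n : ℕ} (s : Fin n × Fin n) : ¬ SegmentsCross s s := by
  rintro (h | h) <;> exact lt_irrefl _ h.1

/-- A triangulation is a maximal set of pairwise non-crossing diagonals. -/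
theorem IsTriangulation.mem_of_not_cross {n : ℕ} (hn : 3 ≤ n) {T : Finset (Fin n × Fin n)}
    (hT : IsTriangulation T) {s : Fin n × Fin n} (hs : PolygonDiagonal s)
    (h : ∀ t ∈ T, ¬ SegmentsCross s t) : s ∈ T := by
  classical
  by_contra hsT
  have := card_add_three_le_of_noncrossing hn (D := insert s T) (by
    intro t ht
    rcases Finset.mem_insert.mp ht with rfl | ht
    · exact hs
    · exact hT.diagonal t ht) (by
    intro t ht u hu
    rcases Finset.mem_insert.mp ht with rfl | ht' <;>
      rcases Finset.mem_insert.mp hu with rfl | hu'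
    · exact not_segmentsCross_self _
    · exact h u hu'
    · exact fun hc => h t ht' hc.symm
    · exact hT.noncrossing t ht' u hu')
  rw [Finset.card_insert_of_notMem hsT] at this
  have := hT.card_add_three
  omega

/-! ### Edges and triangles of a triangulation -/

/-- The segment `s` is a side of the polygon or belongs to `T`. -/
def IsEdgeOf {n : ℕ} (T : Finset (Fin n × Fin n)) (s : Fin n × Fin n) : Prop :=
  PolygonSide s ∨ s ∈ T

theorem IsEdgeOf.not_cross {n : ℕ} {T : Finset (Fin n × Fin n)} {s t : Fin n × Fin n}
    (hs : IsEdgeOf T s) (ht : ∀ u ∈ T, ¬ SegmentsCross t u) : ¬ SegmentsCross t s := by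
  rcases hs with hs | hs
  · exact fun h => hs.not_cross h.symm
  · exact ht s hs

theorem IsTriangulation.isEdgeOf_of_not_cross {n : ℕ} (hn : 3 ≤ n) {T : Finset (Fin n × Fin n)}
    (hT : IsTriangulation T) {s : Fin n × Fin n} (hs : s.1 < s.2)
    (h : ∀ t ∈ T, ¬ SegmentsCross s t) : IsEdgeOf T s := by
  by_cases hside : PolygonSide s
  · exact Or.inl hside
  · exact Or.inr (hT.mem_of_not_cross hn ⟨hs, hside⟩ h)

/-- The triangle of a triangulation lying below the diagonal `(i, j)`. -/
theorem IsTriangulation.exists_inner_apex {n : ℕ} (hn : 3 ≤ n) {T : Finset (Fin n × Fin n)}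
    (hT : IsTriangulation T) {i j : Fin n} (hij : (i, j) ∈ T) :
    ∃ k, i < k ∧ k < j ∧ IsEdgeOf T (i, k) ∧ IsEdgeOf T (k, j) := by
  obtain ⟨k, h1, h2, h3, h4⟩ := exists_last_neighbor T i j (hT.diagonal _ hij).gap
  have h3' : IsEdgeOf T (i, k) := by
    rcases h3 with h3 | h3
    · exact Or.inl ⟨h1, Or.inl h3.symm⟩
    · exact Or.inr h3
  refine ⟨k, h1, h2, h3', hT.isEdgeOf_of_not_cross hn h2 ?_⟩
  rintro ⟨p, q⟩ hpq
  have c1 := hT.noncrossing _ hpq _ hij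
  have c2 := h3'.not_cross (hT.noncrossing _ hpq)
  have c3 : k < q → q < j → p ≠ i := fun a b c => h4 q a b (c ▸ hpq)
  simp only [SegmentsCross, Fin.lt_def, ne_eq, Fin.ext_iff] at *
  omega

/-- The triangle of a triangulation lying above the diagonal `(i, j)`. -/
theorem IsTriangulation.exists_outer_apex {n : ℕ} (hn : 3 ≤ n) {T : Finset (Fin n × Fin n)}
    (hT : IsTriangulation T) {i j : Fin n} (hij : (i, j) ∈ T) :
    (∃ k, k < i ∧ IsEdgeOf T (k, i) ∧ IsEdgeOf T (k, j)) ∨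
      ∃ k, j < k ∧ IsEdgeOf T (i, k) ∧ IsEdgeOf T (j, k) := by
  classical
  have hlt : i < j := (hT.diagonal _ hij).1
  -- If `i` has neighbours beyond `j`, the nearest of them is the apex. Otherwise the apex lies
  -- before `i` and is the smallest neighbour of `i`.
  by_cases hex : ∃ k, j < k ∧ IsEdgeOf T (i, k)
  · right
    obtain ⟨k, hk, hmin⟩ := (Finset.univ.filter fun k => j < k ∧ IsEdgeOf T (i, k)).exists_min_image
      id (by obtain ⟨k, hk⟩ := hex; exact ⟨k, by simpa using hk⟩)
    simp only [Finset.mem_filter, Finset.mem_univ, true_and, id] at hk hmin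
    refine ⟨k, hk.1, hk.2, hT.isEdgeOf_of_not_cross hn hk.1 ?_⟩
    rintro ⟨p, q⟩ hpq
    have c1 := hT.noncrossing _ hpq _ hij
    have c2 := hk.2.not_cross (hT.noncrossing _ hpq)
    have c3 : p = i → j < q → k ≤ q := fun a b => hmin q ⟨b, Or.inr (a ▸ hpq)⟩
    obtain ⟨hk, -⟩ := hk
    clear hmin hex
    simp only [SegmentsCross, Fin.lt_def, Fin.le_def, Fin.ext_iff] at *
    omega
  · left
    push Not at hex
    -- If `i` were the first vertex, the closing side would join it to a vertex beyond `j`.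
    have hi : 0 < (i : ℕ) := by
      rw [Nat.pos_iff_ne_zero]
      intro hi
      have hj := (hT.diagonal _ hij).2
      have hjn : (j : ℕ) ≠ n - 1 := fun h => hj ⟨hlt, Or.inr ⟨hi, by simp only; omega⟩⟩
      refine hex ⟨n - 1, by omega⟩ ?_ (Or.inl ⟨?_, Or.inr ⟨hi, ?_⟩⟩) <;>
        simp only [Fin.lt_def] at * <;> omega
    obtain ⟨k, hk, hmin⟩ := (Finset.univ.filter fun k => k < i ∧ IsEdgeOf T (k, i)).exists_min_image
      id ⟨⟨i - 1, by omega⟩, by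
        simp only [Finset.mem_filter, Finset.mem_univ, true_and]
        refine ⟨?_, Or.inl ⟨?_, Or.inl ?_⟩⟩ <;> simp only [Fin.lt_def] <;> omega⟩
    simp only [Finset.mem_filter, Finset.mem_univ, true_and, id] at hk hmin
    refine ⟨k, hk.1, hk.2, hT.isEdgeOf_of_not_cross hn (hk.1.trans hlt) ?_⟩
    rintro ⟨p, q⟩ hpq
    have c1 := hT.noncrossing _ hpq _ hij
    have c2 := hk.2.not_cross (hT.noncrossing _ hpq)
    have c3 : q = i → p < i → k ≤ p := fun a b => hmin p ⟨b, Or.inr (a ▸ hpq)⟩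
    have c4 : p = i → ¬ j < q := fun a b => hex q b (Or.inr (a ▸ hpq))
    obtain ⟨hk, -⟩ := hk
    clear hmin hex
    simp only [SegmentsCross, Fin.lt_def, Fin.le_def, Fin.ext_iff] at *
    omega

/-! ### Quadrilaterals and flips -/

theorem quadrilateralSides_comm {n : ℕ} (d d' : Fin n × Fin n) :
    quadrilateralSides d d' = quadrilateralSides d' d := by
  ext s
  simp only [quadrilateralSides, Finset.mem_filter, Finset.mem_univ, true_and]
  tauto

theorem quadrilateralSides_eq {n : ℕ} {p q r t : Fin n} (hpq : p < q) (hqr : q < r) (hrt : r < t) :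
    quadrilateralSides (p, r) (q, t) = {(p, q), (q, r), (r, t), (p, t)} := by
  ext ⟨i, j⟩
  simp only [quadrilateralSides, Finset.mem_filter, Finset.mem_univ, true_and, Finset.mem_insert,
    Finset.mem_singleton, Prod.mk.injEq, Fin.ext_iff, Fin.lt_def] at *
  omega

/-- A segment meeting a side of a quadrilateral meets one of its diagonals. -/
theorem segmentsCross_of_cross_side {n : ℕ} {d d' s u : Fin n × Fin n} (h : SegmentsCross d d')
    (hs : s ∈ quadrilateralSides d d') (hu : SegmentsCross u s) :
    SegmentsCross u d ∨ SegmentsCross u d' := by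
  have key : ∀ {p q r t : Fin n}, p < q → q < r → r < t → s ∈ quadrilateralSides (p, r) (q, t) →
      SegmentsCross u (p, r) ∨ SegmentsCross u (q, t) := by
    intro p q r t hpq hqr hrt hs
    rw [quadrilateralSides_eq hpq hqr hrt] at hs
    simp only [Finset.mem_insert, Finset.mem_singleton] at hs
    obtain ⟨i, j⟩ := u
    rcases hs with rfl | rfl | rfl | rfl <;>
      simp only [SegmentsCross, Fin.lt_def] at * <;> omega
  obtain ⟨p, r⟩ := d
  obtain ⟨q, t⟩ := d'
  rcases h with ⟨h1, h2, h3⟩ | ⟨h1, h2, h3⟩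
  · exact key h1 h2 h3 hs
  · exact (key h1 h2 h3 (quadrilateralSides_comm _ _ ▸ hs)).symm

/-- A segment meeting a diagonal of a quadrilateral but none of its sides is the other diagonal. -/
theorem eq_of_cross_of_not_cross_sides {n : ℕ} {d d' u : Fin n × Fin n} (h : SegmentsCross d d')
    (hs : ∀ s ∈ quadrilateralSides d d', ¬ SegmentsCross u s) (hu : SegmentsCross u d) :
    u = d' := by
  obtain ⟨p, r⟩ := d
  obtain ⟨q, t⟩ := d'
  obtain ⟨i, j⟩ := u
  rcases h with ⟨h1, h2, h3⟩ | ⟨h1, h2, h3⟩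
  · rw [quadrilateralSides_eq h1 h2 h3] at hs
    simp only [Finset.mem_insert, Finset.mem_singleton, forall_eq_or_imp, forall_eq,
      SegmentsCross, Fin.lt_def, Prod.mk.injEq, Fin.ext_iff] at *
    omega
  · rw [quadrilateralSides_comm, quadrilateralSides_eq h1 h2 h3] at hs
    simp only [Finset.mem_insert, Finset.mem_singleton, forall_eq_or_imp, forall_eq,
      SegmentsCross, Fin.lt_def, Prod.mk.injEq, Fin.ext_iff] at *
    omega

theorem not_cross_of_mem_quadrilateralSides {n : ℕ} {d d' s : Fin n × Fin n}
    (h : SegmentsCross d d') (hs : s ∈ quadrilateralSides d d') : ¬ SegmentsCross s d := by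
  obtain ⟨p, r⟩ := d
  obtain ⟨q, t⟩ := d'
  obtain ⟨i, j⟩ := s
  simp only [quadrilateralSides, Finset.mem_filter, Finset.mem_univ, true_and, SegmentsCross,
    Fin.lt_def, Fin.ext_iff] at *
  omega

theorem IsTriangulation.eq_of_subset {n : ℕ} {T T' : Finset (Fin n × Fin n)}
    (hT : IsTriangulation T) (hT' : IsTriangulation T') (h : T ⊆ T') : T = T' :=
  Finset.eq_of_subset_of_card_le h (by
    have := hT.card_add_three
    have := hT'.card_add_three
    omega)

/-- `T'` arises from `T` by replacing the diagonal `d` with the diagonal `d'`. -/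
structure IsFlip {n : ℕ} (T T' : PolygonTriangulation n) (d d' : Fin n × Fin n) : Prop where
  sdiff_left : T.1 \ T'.1 = {d}
  sdiff_right : T'.1 \ T.1 = {d'}
  cross : SegmentsCross d d'

namespace IsFlip

variable {n : ℕ} {T T' : PolygonTriangulation n} {d d' : Fin n × Fin n}

theorem symm (h : IsFlip T T' d d') : IsFlip T' T d' d :=
  ⟨h.sdiff_right, h.sdiff_left, h.cross.symm⟩

theorem left_mem (h : IsFlip T T' d d') : d ∈ T.1 ∧ d ∉ T'.1 := by
  rw [← Finset.mem_sdiff, h.sdiff_left, Finset.mem_singleton]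

theorem right_mem (h : IsFlip T T' d d') : d' ∈ T'.1 ∧ d' ∉ T.1 := h.symm.left_mem

theorem mem_right (h : IsFlip T T' d d') {s : Fin n × Fin n} (hs : s ∈ T.1) (hsd : s ≠ d) :
    s ∈ T'.1 := by
  by_contra hs'
  have : s ∈ T.1 \ T'.1 := Finset.mem_sdiff.mpr ⟨hs, hs'⟩
  rw [h.sdiff_left, Finset.mem_singleton] at this
  exact hsd this

theorem mem_left (h : IsFlip T T' d d') {s : Fin n × Fin n} (hs : s ∈ T'.1) (hsd : s ≠ d') :
    s ∈ T.1 := h.symm.mem_right hs hsd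

theorem mem_right_iff (h : IsFlip T T' d d') {s : Fin n × Fin n} :
    s ∈ T'.1 ↔ s = d' ∨ s ∈ T.1 ∧ s ≠ d := by
  constructor
  · intro hs
    by_cases hsd : s = d'
    · exact Or.inl hsd
    · exact Or.inr ⟨h.mem_left hs hsd, fun e => h.left_mem.2 (e ▸ hs)⟩
  · rintro (rfl | ⟨hs, hsd⟩)
    · exact h.right_mem.1
    · exact h.mem_right hs hsd

/-- The sides of the quadrilateral of a flip are sides of the polygon or common diagonals. -/
theorem isEdgeOf_side (hn : 3 ≤ n) (h : IsFlip T T' d d') {s : Fin n × Fin n}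
    (hs : s ∈ quadrilateralSides d d') : IsEdgeOf (T.1 ∩ T'.1) s := by
  have hlt : s.1 < s.2 := by
    simp only [quadrilateralSides, Finset.mem_filter] at hs
    exact hs.2.1
  have hsd := not_cross_of_mem_quadrilateralSides h.cross hs
  have hsd' := not_cross_of_mem_quadrilateralSides h.cross.symm (quadrilateralSides_comm d d' ▸ hs)
  have hI : ∀ t ∈ T.1, t ∈ T'.1 → ¬ SegmentsCross s t := fun t ht ht' hc =>
    (segmentsCross_of_cross_side h.cross hs hc.symm).elim
      (T.2.noncrossing _ ht _ h.left_mem.1) (T'.2.noncrossing _ ht' _ h.right_mem.1)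
  have h1 : IsEdgeOf T.1 s := T.2.isEdgeOf_of_not_cross hn hlt fun t ht => by
    by_cases htd : t = d
    · exact htd ▸ hsd
    · exact hI t ht (h.mem_right ht htd)
  have h2 : IsEdgeOf T'.1 s := T'.2.isEdgeOf_of_not_cross hn hlt fun t ht => by
    by_cases htd : t = d'
    · exact htd ▸ hsd'
    · exact hI t (h.mem_left ht htd) ht
  rcases h1 with h1 | h1
  · exact Or.inl h1
  rcases h2 with h2 | h2
  · exact Or.inl h2
  exact Or.inr (Finset.mem_inter.mpr ⟨h1, h2⟩)

end IsFlip

/-- Counting leaves one diagonal on each side. If these did not cross, the new one would cross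
nothing in `T` and would belong to `T` by maximality. -/
theorem exists_isFlip {n : ℕ} (hn : 3 ≤ n) {T T' : PolygonTriangulation n}
    (h : (associahedronGraph n).Adj T T') : ∃ d d', IsFlip T T' d d' := by
  have hc := T.2.card_add_three
  have hc' := T'.2.card_add_three
  have hi := h.2
  have h1 := Finset.card_sdiff_add_card_inter T.1 T'.1
  have h2 := Finset.card_sdiff_add_card_inter T'.1 T.1
  rw [Finset.inter_comm] at h2
  obtain ⟨d, hd⟩ := Finset.card_eq_one.mp (show (T.1 \ T'.1).card = 1 by omega)
  obtain ⟨d', hd'⟩ := Finset.card_eq_one.mp (show (T'.1 \ T.1).card = 1 by omega)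
  refine ⟨d, d', hd, hd', ?_⟩
  by_contra hcr
  have hm : d' ∈ T'.1 \ T.1 := hd' ▸ Finset.mem_singleton_self d'
  rw [Finset.mem_sdiff] at hm
  refine hm.2 (T.2.mem_of_not_cross hn (T'.2.diagonal _ hm.1) fun t ht hc => ?_)
  by_cases htT : t ∈ T'.1
  · exact T'.2.noncrossing _ hm.1 _ htT hc
  · have : t ∈ T.1 \ T'.1 := Finset.mem_sdiff.mpr ⟨ht, htT⟩
    rw [hd, Finset.mem_singleton] at this
    exact hcr (this ▸ hc.symm)

/-- At most two triangulations contain given `n - 4` diagonals. -/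
theorem IsFlip.eq_or_eq {n : ℕ} (hn : 3 ≤ n) {T T' R : PolygonTriangulation n}
    {d d' : Fin n × Fin n} (h : IsFlip T T' d d') (hR : T.1 ∩ T'.1 ⊆ R.1) : R = T ∨ R = T' := by
  by_contra! hne
  have hRT : ¬ R.1 ⊆ T.1 := fun hs => hne.1 (Subtype.ext (R.2.eq_of_subset T.2 hs))
  obtain ⟨c, hcR, hcT⟩ := Finset.not_subset.mp hRT
  have hcd : SegmentsCross c d := by
    by_contra hcd
    refine hcT (T.2.mem_of_not_cross hn (R.2.diagonal _ hcR) fun t ht => ?_)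
    by_cases htd : t = d
    · exact htd ▸ hcd
    · exact R.2.noncrossing _ hcR _ (hR (Finset.mem_inter.mpr ⟨ht, h.mem_right ht htd⟩))
  -- The sides of the quadrilateral are edges of `R` as well, so `c` crosses none of them.
  have hc : c = d' := eq_of_cross_of_not_cross_sides h.cross (fun s hs =>
    (h.isEdgeOf_side hn hs).not_cross fun u hu => R.2.noncrossing _ hcR _ (hR hu)) hcd
  refine hne.2 (Subtype.ext (T'.2.eq_of_subset R.2 fun s hs => ?_).symm)
  by_cases hsd : s = d'
  · exact hsd ▸ hc ▸ hcR
  · exact hR (Finset.mem_inter.mpr ⟨h.mem_left hs hsd, hs⟩)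

/-- Distinct flips of a triangulation remove distinct diagonals. -/
theorem IsFlip.removed_ne {n : ℕ} (hn : 3 ≤ n) {T T' R : PolygonTriangulation n}
    {d d' x x' : Fin n × Fin n} (h : IsFlip T T' d d') (hR : IsFlip T R x x') (hne : R ≠ T') :
    x ≠ d := by
  rintro rfl
  rcases h.eq_or_eq hn (R := R) (fun s hs => by
    rw [Finset.mem_inter] at hs
    exact hR.mem_right hs.1 fun e => h.left_mem.2 (e ▸ hs.2)) with e | e
  · subst e
    exact hR.left_mem.2 hR.left_mem.1
  · exact hne e

/-! ### Triangles and five-cycles of the flip graph -/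

/-- Two different flips of `T₀` remove different diagonals. A flip between the results would
exchange these two diagonals, so they would cross, although both belong to `T₀`. -/
theorem associahedronGraph_triangle_free {n : ℕ} (hn : 3 ≤ n) {T₀ T₁ T₂ : PolygonTriangulation n}
    (h₁ : (associahedronGraph n).Adj T₀ T₁) (h₂ : (associahedronGraph n).Adj T₀ T₂) :
    ¬ (associahedronGraph n).Adj T₁ T₂ := by
  intro h₃
  obtain ⟨a, b, h₁⟩ := exists_isFlip hn h₁
  obtain ⟨a', c, h₂⟩ := exists_isFlip hn h₂
  have hne := h₃.1
  obtain ⟨p, q, h₃⟩ := exists_isFlip hn h₃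
  have haa : a' ≠ a := h₁.removed_ne hn h₂ hne.symm
  have e₁ : a' = p := by
    by_contra e
    exact h₂.left_mem.2 (h₃.mem_right (h₁.mem_right h₂.left_mem.1 haa) e)
  have e₂ : a = q := by
    by_contra e
    exact h₁.left_mem.2 (h₃.mem_left (h₂.mem_right h₁.left_mem.1 haa.symm) e)
  exact T₀.2.noncrossing _ h₂.left_mem.1 _ h₁.left_mem.1 (e₁ ▸ e₂ ▸ h₃.cross)

/-- The triangulations on a five-cycle through a flip share all diagonals common to the two
flipped triangulations, except for one side of the quadrilateral of the flip. -/
theorem IsFlip.exists_side_of_five_cycle {n : ℕ} (hn : 3 ≤ n)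
    {T₀ T₁ T₂ T₃ T₄ : PolygonTriangulation n} {d d' : Fin n × Fin n} (h : IsFlip T₀ T₁ d d')
    (h₁₂ : (associahedronGraph n).Adj T₁ T₂) (h₂₃ : (associahedronGraph n).Adj T₂ T₃)
    (h₃₄ : (associahedronGraph n).Adj T₃ T₄) (h₄₀ : (associahedronGraph n).Adj T₄ T₀)
    (hne₀₂ : T₀ ≠ T₂) (hne₁₄ : T₁ ≠ T₄) (hne₂₄ : T₂ ≠ T₄) :
    ∃ x ∈ quadrilateralSides d d', ¬ PolygonSide x ∧
      ∀ s ∈ T₀.1 ∩ T₁.1, s ≠ x → s ∈ T₂.1 ∧ s ∈ T₃.1 ∧ s ∈ T₄.1 := by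
  have hnadj : ¬ (associahedronGraph n).Adj T₂ T₄ :=
    associahedronGraph_triangle_free hn h₂₃.symm h₃₄
  obtain ⟨x, x', hx⟩ := exists_isFlip hn h₄₀.symm
  obtain ⟨y, y', hy⟩ := exists_isFlip hn h₁₂
  obtain ⟨p, p', hp⟩ := exists_isFlip hn h₂₃
  obtain ⟨q, q', hq⟩ := exists_isFlip hn h₃₄
  have hxd : x ≠ d := h.removed_ne hn hx hne₁₄.symm
  have hyd : y ≠ d' := h.symm.removed_ne hn hy hne₀₂.symm
  have hx₁ : x ∈ T₁.1 := h.mem_right hx.left_mem.1 hxd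
  have hy₀ : y ∈ T₀.1 := h.mem_left hy.left_mem.1 hyd
  have hd₄ : d ∈ T₄.1 := hx.mem_right h.left_mem.1 hxd.symm
  have hd'₂ : d' ∈ T₂.1 := hy.mem_right h.right_mem.1 hyd.symm
  have hd'₄ : d' ∉ T₄.1 := fun hm => T₄.2.noncrossing _ hd₄ _ hm h.cross
  -- at most two diagonals of `T₂` are missing in `T₄`
  have htwo : ∀ s ∈ T₂.1, s ∉ T₄.1 → s = p ∨ s = q := by
    intro s hs hs'
    by_contra! hne
    exact hs' (hq.mem_right (hp.mem_right hs hne.1) hne.2)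
  -- Otherwise `T₂` has three diagonals `d'`, `x`, `y'` missing from `T₄`.
  have hxy : x = y := by
    by_contra hxy
    have hx₂ : x ∈ T₂.1 := hy.mem_right hx₁ hxy
    have hy₄ : y ∈ T₄.1 := hx.mem_right hy₀ (Ne.symm hxy)
    have hx'y : SegmentsCross y y' := hy.cross
    have hy'₄ : y' ∉ T₄.1 := fun hm => T₄.2.noncrossing _ hy₄ _ hm hx'y
    have e₁ := htwo _ hd'₂ hd'₄
    have e₂ := htwo _ hx₂ hx.left_mem.2
    have e₃ := htwo _ hy.right_mem.1 hy'₄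
    have n₁ : d' ≠ x := fun e => h.right_mem.2 (e ▸ hx.left_mem.1)
    have n₂ : d' ≠ y' := fun e => hy.right_mem.2 (e ▸ h.right_mem.1)
    have n₃ : x ≠ y' := fun e => hy.right_mem.2 (e ▸ hx₁)
    grind
  subst hxy
  have hJ : ∀ s ∈ T₀.1, s ∈ T₁.1 → s ≠ x → s ∈ T₂.1 ∧ s ∈ T₃.1 ∧ s ∈ T₄.1 := by
    intro s hs₀ hs₁ hsx
    have hs₂ := hy.mem_right hs₁ hsx
    have hs₄ := hx.mem_right hs₀ hsx
    refine ⟨hs₂, ?_, hs₄⟩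
    -- If `s` is absent from `T₃`, the flips around `T₃` remove and reinsert `s`. They then leave
    -- `d'` and `d` untouched, and both crossing diagonals lie in `T₃`.
    by_contra hs₃
    have e₁ : s = p := by
      by_contra e
      exact hs₃ (hp.mem_right hs₂ e)
    have e₂ : s = q' := by
      by_contra e
      exact hs₃ (hq.mem_left hs₄ e)
    have m₁ : d' ∈ T₃.1 := hp.mem_right hd'₂ fun e => h.right_mem.2 (e ▸ e₁ ▸ hs₀)
    have m₂ : d ∈ T₃.1 := hq.mem_left hd₄ fun e => h.left_mem.2 (e ▸ e₂ ▸ hs₁)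
    exact T₃.2.noncrossing _ m₂ _ m₁ h.cross
  have hxside : ¬ PolygonSide x := (T₀.2.diagonal _ hx.left_mem.1).2
  refine ⟨x, ?_, hxside, fun s hs => hJ s (Finset.mem_inter.mp hs).1 (Finset.mem_inter.mp hs).2⟩
  by_contra hxs
  -- otherwise `x'` also completes `T₁ \ {x}` to a triangulation, which then is `T₂`
  have hx'₄ := T₄.2.noncrossing _ hx.right_mem.1
  -- As `x` is not a side of the quadrilateral, all its sides are still edges of `T₄`. So `x'` could
  -- cross `d'` only by being `d`, which lies in `T₀`.
  have hx'd' : ¬ SegmentsCross x' d' := fun hc => by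
    have := eq_of_cross_of_not_cross_sides h.cross.symm (u := x') (fun s hs => by
      rw [quadrilateralSides_comm] at hs
      rcases h.isEdgeOf_side hn hs with he | he
      · exact fun hc => he.not_cross hc.symm
      · refine hx'₄ _ (hx.mem_right (Finset.mem_inter.mp he).1 ?_)
        rintro rfl
        exact hxs hs) hc
    exact hx.right_mem.2 (this ▸ h.left_mem.1)
  have hx'J : ∀ s ∈ T₁.1, s ≠ x → ¬ SegmentsCross x' s := by
    intro s hs hsx
    by_cases hsd : s = d'
    · exact hsd ▸ hx'd'
    · exact hx'₄ _ (hJ _ (h.mem_left hs hsd) hs hsx).2.2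
  have hx'₂ : x' ∈ T₂.1 := by
    refine T₂.2.mem_of_not_cross hn (T₄.2.diagonal _ hx.right_mem.1) fun s hs hc => ?_
    rcases hy.mem_right_iff.mp hs with rfl | ⟨hs₁, hsx⟩
    · have := eq_of_cross_of_not_cross_sides hy.cross.symm (u := x') (fun u hu => by
        rw [quadrilateralSides_comm] at hu
        rcases hy.isEdgeOf_side hn hu with he | he
        · exact fun hc => he.not_cross hc.symm
        · rw [Finset.mem_inter] at he
          exact hx'J u he.1 fun e => hy.left_mem.2 (e ▸ he.2)) hc
      exact hx.left_mem.2 (this ▸ hx.right_mem.1)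
    · exact hx'J s hs₁ hsx hc
  have hx'y' : x' = y' := by
    by_contra e
    refine hx.right_mem.2 (h.mem_left (hy.mem_left hx'₂ e) ?_)
    rintro rfl
    exact hd'₄ hx.right_mem.1
  -- This makes `T₂` and `T₄` adjacent, closing a triangle with `T₃`.
  have hsd : T₂.1 \ T₄.1 = {d'} := by
    refine (Finset.eq_singleton_iff_unique_mem).mpr ⟨Finset.mem_sdiff.mpr ⟨hd'₂, hd'₄⟩, ?_⟩
    intro s hs
    rw [Finset.mem_sdiff] at hs
    by_contra hsd
    rcases hy.mem_right_iff.mp hs.1 with rfl | ⟨hs₁, hsx⟩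
    · exact hs.2 (hx'y' ▸ hx.right_mem.1)
    · exact hs.2 (hJ s (h.mem_left hs₁ hsd) hs₁ hsx).2.2
  have hc := Finset.card_sdiff_add_card_inter T₂.1 T₄.1
  rw [hsd, Finset.card_singleton] at hc
  have := T₂.2.card_add_three
  exact hnadj ⟨hne₂₄, by omega⟩

/-! ### Pentagons and their five triangulations -/

/-- The diagonals of the pentagon with vertices `a < b < c < d < e`, listed in such a way that
consecutive ones do not cross. -/
def pentagonDiagonal {n : ℕ} (a b c d e : Fin n) : Fin 5 → Fin n × Fin n :=
  ![(a, c), (a, d), (b, d), (b, e), (c, e)]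

/-- This turns crossing questions inside a pentagon into finite checks on `Fin 5`. -/
theorem segmentsCross_pentagonDiagonal_iff {n : ℕ} {a b c d e : Fin n} (hab : a < b) (hbc : b < c)
    (hcd : c < d) (hde : d < e) (k l : Fin 5) :
    SegmentsCross (pentagonDiagonal a b c d e k) (pentagonDiagonal a b c d e l) ↔
      l = k + 2 ∨ l = k + 3 := by
  have h : ∀ k l : Fin 5, (l = k + 2 ∨ l = k + 3) ↔
    l.val = (k.val + 2) % 5 ∨ l.val = (k.val + 3) % 5 := by decide
  rw [h]
  fin_cases k <;> fin_cases l <;>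
    simp only [pentagonDiagonal, SegmentsCross, Fin.lt_def, Fin.reduceFinMk, Matrix.cons_val] at * <;>
    simp <;> omega

theorem pentagonDiagonal_injective {n : ℕ} {a b c d e : Fin n} (hab : a < b) (hbc : b < c)
    (hcd : c < d) (hde : d < e) : Function.Injective (pentagonDiagonal a b c d e) := by
  intro k l h
  have h₁ : ∀ m, SegmentsCross (pentagonDiagonal a b c d e k) (pentagonDiagonal a b c d e m) ↔
      SegmentsCross (pentagonDiagonal a b c d e l) (pentagonDiagonal a b c d e m) := fun m => by
    rw [h]
  simp only [segmentsCross_pentagonDiagonal_iff hab hbc hcd hde] at h₁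
  revert k l
  -- A pentagon diagonal is determined by the two it crosses.
  have : ∀ k l : Fin 5, (∀ m, (m = k + 2 ∨ m = k + 3) ↔ (m = l + 2 ∨ m = l + 3)) → k = l := by
    decide
  exact fun k l _ h₁ => this k l h₁

/-- A segment meeting a diagonal of a pentagon but none of its sides is a diagonal of the
pentagon. -/
theorem exists_eq_pentagonDiagonal {n : ℕ} {a b c d e : Fin n} (hab : a < b) (hbc : b < c)
    (hcd : c < d) (hde : d < e) {u : Fin n × Fin n} (h₁ : ¬ SegmentsCross u (a, b))
    (h₂ : ¬ SegmentsCross u (b, c)) (h₃ : ¬ SegmentsCross u (c, d)) (h₄ : ¬ SegmentsCross u (d, e))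
    (h₅ : ¬ SegmentsCross u (a, e)) {k : Fin 5}
    (hk : SegmentsCross u (pentagonDiagonal a b c d e k)) :
    ∃ l, u = pentagonDiagonal a b c d e l := by
  obtain ⟨i, j⟩ := u
  have : (i, j) = (a, c) ∨ (i, j) = (a, d) ∨ (i, j) = (b, d) ∨ (i, j) = (b, e) ∨
      (i, j) = (c, e) := by
    fin_cases k <;>
      simp only [pentagonDiagonal, SegmentsCross, Fin.lt_def, Fin.reduceFinMk, Matrix.cons_val,
        Prod.mk.injEq, Fin.ext_iff] at * <;> grind
  rcases this with h | h | h | h | h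
  · exact ⟨0, h⟩
  · exact ⟨1, h⟩
  · exact ⟨2, h⟩
  · exact ⟨3, h⟩
  · exact ⟨4, h⟩

theorem polygonDiagonal_pentagonDiagonal {n : ℕ} {a b c d e : Fin n} (hab : a < b) (hbc : b < c)
    (hcd : c < d) (hde : d < e) (k : Fin 5) : PolygonDiagonal (pentagonDiagonal a b c d e k) := by
  have := e.isLt
  fin_cases k <;>
    simp only [pentagonDiagonal, PolygonDiagonal, PolygonSide, Fin.lt_def, Fin.reduceFinMk,
      Matrix.cons_val] at * <;> omega

/-- `J` dissects the polygon into triangles and the pentagon with vertices `a < b < c < d < e`. -/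
structure IsPentagon {n : ℕ} (J : Finset (Fin n × Fin n)) (a b c d e : Fin n) : Prop where
  hab : a < b
  hbc : b < c
  hcd : c < d
  hde : d < e
  edge_ab : IsEdgeOf J (a, b)
  edge_bc : IsEdgeOf J (b, c)
  edge_cd : IsEdgeOf J (c, d)
  edge_de : IsEdgeOf J (d, e)
  edge_ae : IsEdgeOf J (a, e)
  diagonal : ∀ s ∈ J, PolygonDiagonal s
  noncrossing : ∀ s ∈ J, ∀ t ∈ J, ¬ SegmentsCross s t
  card_add_five : J.card + 5 = n
  notMem : ∀ k, pentagonDiagonal a b c d e k ∉ J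

namespace IsPentagon

variable {n : ℕ} {J : Finset (Fin n × Fin n)} {a b c d e : Fin n}

theorem injective (h : IsPentagon J a b c d e) :
    Function.Injective (pentagonDiagonal a b c d e) :=
  pentagonDiagonal_injective h.hab h.hbc h.hcd h.hde

theorem cross_iff (h : IsPentagon J a b c d e) (k l : Fin 5) :
    SegmentsCross (pentagonDiagonal a b c d e k) (pentagonDiagonal a b c d e l) ↔
      l = k + 2 ∨ l = k + 3 :=
  segmentsCross_pentagonDiagonal_iff h.hab h.hbc h.hcd h.hde k l

theorem exists_eq_of_cross (h : IsPentagon J a b c d e) {u : Fin n × Fin n}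
    (hu : ∀ t ∈ J, ¬ SegmentsCross u t) {k : Fin 5}
    (hk : SegmentsCross u (pentagonDiagonal a b c d e k)) :
    ∃ l, u = pentagonDiagonal a b c d e l :=
  exists_eq_pentagonDiagonal h.hab h.hbc h.hcd h.hde (h.edge_ab.not_cross hu)
    (h.edge_bc.not_cross hu) (h.edge_cd.not_cross hu) (h.edge_de.not_cross hu)
    (h.edge_ae.not_cross hu) hk

theorem not_cross_of_mem (h : IsPentagon J a b c d e) {u : Fin n × Fin n} (hu : u ∈ J)
    (k : Fin 5) : ¬ SegmentsCross u (pentagonDiagonal a b c d e k) := fun hc => by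
  obtain ⟨l, rfl⟩ := h.exists_eq_of_cross (h.noncrossing u hu) hc
  exact h.notMem l hu

theorem disjoint_image (h : IsPentagon J a b c d e) (M : Finset (Fin 5)) :
    Disjoint J (M.image (pentagonDiagonal a b c d e)) := by
  rw [Finset.disjoint_right]
  intro s hs
  obtain ⟨k, -, rfl⟩ := Finset.mem_image.mp hs
  exact h.notMem k

theorem card_union_image (h : IsPentagon J a b c d e) (M : Finset (Fin 5)) :
    (J ∪ M.image (pentagonDiagonal a b c d e)).card = J.card + M.card := by
  rw [Finset.card_union_of_disjoint (h.disjoint_image M), Finset.card_image_of_injective _ h.injective]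

theorem isTriangulation (h : IsPentagon J a b c d e) (k : Fin 5) :
    IsTriangulation (J ∪ ({k, k + 1} : Finset (Fin 5)).image (pentagonDiagonal a b c d e)) where
  diagonal s hs := by
    rcases Finset.mem_union.mp hs with hs | hs
    · exact h.diagonal s hs
    · obtain ⟨l, -, rfl⟩ := Finset.mem_image.mp hs
      exact polygonDiagonal_pentagonDiagonal h.hab h.hbc h.hcd h.hde l
  noncrossing s hs t ht := by
    rcases Finset.mem_union.mp hs with hs | hs <;> rcases Finset.mem_union.mp ht with ht | ht
    · exact h.noncrossing s hs t ht
    · obtain ⟨l, -, rfl⟩ := Finset.mem_image.mp ht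
      exact h.not_cross_of_mem hs l
    · obtain ⟨l, -, rfl⟩ := Finset.mem_image.mp hs
      exact fun hc => h.not_cross_of_mem ht l hc.symm
    · obtain ⟨l, hl, rfl⟩ := Finset.mem_image.mp hs
      obtain ⟨m, hm, rfl⟩ := Finset.mem_image.mp ht
      rw [h.cross_iff]
      have : ∀ k l m : Fin 5, l ∈ ({k, k + 1} : Finset (Fin 5)) →
        m ∈ ({k, k + 1} : Finset (Fin 5)) → ¬ (m = l + 2 ∨ m = l + 3) := by decide
      exact this k l m hl hm
  card_add_three := by
    have : ∀ k : Fin 5, ({k, k + 1} : Finset (Fin 5)).card = 2 := by decide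
    rw [h.card_union_image, this]
    have := h.card_add_five
    omega

/-- If `u` crosses a pentagon diagonal, it is itself one, since it cannot cross the pentagon's
sides. If it crosses none, maximality puts it into a triangulation refining `J`. -/
theorem exists_eq (h : IsPentagon J a b c d e) {u : Fin n × Fin n} (hd : PolygonDiagonal u)
    (huJ : u ∉ J) (hu : ∀ t ∈ J, ¬ SegmentsCross u t) :
    ∃ l, u = pentagonDiagonal a b c d e l := by
  by_cases hc : ∃ k, SegmentsCross u (pentagonDiagonal a b c d e k)
  · obtain ⟨k, hk⟩ := hc
    exact h.exists_eq_of_cross hu hk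
  · push Not at hc
    have hm := (h.isTriangulation 0).mem_of_not_cross (by have := h.card_add_five; omega) hd
      fun t ht => by
        rcases Finset.mem_union.mp ht with ht | ht
        · exact hu t ht
        · obtain ⟨l, -, rfl⟩ := Finset.mem_image.mp ht
          exact hc l
    rcases Finset.mem_union.mp hm with hm | hm
    · exact absurd hm huJ
    · obtain ⟨l, -, rfl⟩ := Finset.mem_image.mp hm
      exact ⟨l, rfl⟩

/-- The five triangulations refining a dissection into triangles and one pentagon. -/
def triangulation (h : IsPentagon J a b c d e) (k : Fin 5) : PolygonTriangulation n :=
  ⟨J ∪ ({k, k + 1} : Finset (Fin 5)).image (pentagonDiagonal a b c d e), h.isTriangulation k⟩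

theorem subset_triangulation (h : IsPentagon J a b c d e) (k : Fin 5) :
    J ⊆ (h.triangulation k).1 := Finset.subset_union_left

theorem card_inter_triangulation (h : IsPentagon J a b c d e) (k l : Fin 5) :
    ((h.triangulation k).1 ∩ (h.triangulation l).1).card =
      J.card + (({k, k + 1} : Finset (Fin 5)) ∩ {l, l + 1}).card := by
  rw [← h.card_union_image, Finset.image_inter _ _ h.injective, Finset.union_inter_distrib_left]
  rfl

theorem triangulation_injective (h : IsPentagon J a b c d e) :
    Function.Injective h.triangulation := by
  intro k l hkl
  have hc := h.card_inter_triangulation k l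
  rw [hkl, Finset.inter_self] at hc
  have := (h.triangulation l).2.card_add_three
  have := h.card_add_five
  have h2 : (({k, k + 1} : Finset (Fin 5)) ∩ {l, l + 1}).card = 2 := by omega
  revert k l
  have : ∀ k l : Fin 5, (({k, k + 1} : Finset (Fin 5)) ∩ {l, l + 1}).card = 2 → k = l := by decide
  exact fun k l _ _ _ h => this k l h

/-- Beyond `J`, the triangulations contribute the pairs `{k, k + 1}` and `{l, l + 1}`, which share
exactly one index when `k` and `l` are cyclic neighbours. -/
theorem adj_triangulation_iff (h : IsPentagon J a b c d e) (k l : Fin 5) :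
    (associahedronGraph n).Adj (h.triangulation k) (h.triangulation l) ↔
      (SimpleGraph.cycleGraph 5).Adj k l := by
  have hd : ∀ k l : Fin 5, (SimpleGraph.cycleGraph 5).Adj k l ↔
    k ≠ l ∧ (({k, k + 1} : Finset (Fin 5)) ∩ {l, l + 1}).card = 1 := by decide
  rw [hd, ← h.triangulation_injective.ne_iff]
  refine and_congr_right fun _ => ?_
  rw [h.card_inter_triangulation]
  have := h.card_add_five
  omega

/-- Counting leaves two diagonals outside `J`. They are non-crossing pentagon diagonals, hence
cyclically consecutive. -/
theorem exists_triangulation_eq (h : IsPentagon J a b c d e) {R : PolygonTriangulation n}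
    (hR : J ⊆ R.1) : ∃ k, h.triangulation k = R := by
  have hmem : ∀ s ∈ R.1, s ∉ J → ∃ l, s = pentagonDiagonal a b c d e l := fun s hs hsJ =>
    h.exists_eq (R.2.diagonal s hs) hsJ fun t ht => R.2.noncrossing s hs t (hR ht)
  have hcard : (R.1 \ J).card = 2 := by
    have h₁ := Finset.card_sdiff_add_card_eq_card hR
    have h₂ := R.2.card_add_three
    have h₃ := h.card_add_five
    omega
  obtain ⟨s, t, hst, hRJ⟩ := Finset.card_eq_two.mp hcard
  have hs : s ∈ R.1 \ J := by simp [hRJ]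
  have ht : t ∈ R.1 \ J := by simp [hRJ]
  rw [Finset.mem_sdiff] at hs ht
  obtain ⟨k, rfl⟩ := hmem s hs.1 hs.2
  obtain ⟨l, rfl⟩ := hmem t ht.1 ht.2
  have hc := R.2.noncrossing _ hs.1 _ ht.1
  rw [h.cross_iff] at hc
  have hkl : k ≠ l := fun e => hst (e ▸ rfl)
  have hdec : ∀ k l : Fin 5, k ≠ l → ¬ (l = k + 2 ∨ l = k + 3) → l = k + 1 ∨ k = l + 1 := by decide
  have hsub : ∀ m : Fin 5, (∀ i ∈ ({m, m + 1} : Finset (Fin 5)), i = k ∨ i = l) →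
      h.triangulation m = R := by
    intro m hm
    refine Subtype.ext ((h.isTriangulation m).eq_of_subset R.2 ?_)
    refine Finset.union_subset hR fun u hu => ?_
    obtain ⟨i, hi, rfl⟩ := Finset.mem_image.mp hu
    rcases hm i hi with rfl | rfl
    · exact hs.1
    · exact ht.1
  rcases hdec k l hkl hc with rfl | rfl
  · exact ⟨k, hsub k (by simp)⟩
  · exact ⟨l, hsub l (by simp [or_comm])⟩

theorem nonempty_iso (h : IsPentagon J a b c d e) :
    Nonempty (((⊤ : (associahedronGraph n).Subgraph).induce
      {R : PolygonTriangulation n | J ⊆ R.1}).coe ≃g SimpleGraph.cycleGraph 5) := by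
  let f : Fin 5 → {R : PolygonTriangulation n | J ⊆ R.1} := fun k =>
    ⟨h.triangulation k, h.subset_triangulation k⟩
  have hf : Function.Bijective f := by
    refine ⟨fun k l hkl => h.triangulation_injective (congrArg Subtype.val hkl), ?_⟩
    rintro ⟨R, hR⟩
    obtain ⟨k, hk⟩ := h.exists_triangulation_eq hR
    exact ⟨k, Subtype.ext hk⟩
  refine ⟨RelIso.symm ⟨Equiv.ofBijective f hf, ?_⟩⟩
  intro k l
  rw [← h.adj_triangulation_iff k l]
  simp only [SimpleGraph.Subgraph.coe_adj, SimpleGraph.Subgraph.induce_adj,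
    SimpleGraph.Subgraph.top_adj]
  exact ⟨fun hh => hh.2.2, fun hh => ⟨h.subset_triangulation k, h.subset_triangulation l, hh⟩⟩

end IsPentagon

theorem IsFlip.isPentagon {n : ℕ} {T T' : PolygonTriangulation n} {x x' s : Fin n × Fin n}
    (h : IsFlip T T' x x') {a b c d e : Fin n} (hab : a < b) (hbc : b < c) (hcd : c < d)
    (hde : d < e) (e₁ : IsEdgeOf T.1 (a, b)) (e₂ : IsEdgeOf T.1 (b, c)) (e₃ : IsEdgeOf T.1 (c, d))
    (e₄ : IsEdgeOf T.1 (d, e)) (e₅ : IsEdgeOf T.1 (a, e)) (hs : s ∈ T.1 ∩ T'.1) {i j m : Fin 5}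
    (hx : x = pentagonDiagonal a b c d e i) (hx' : x' = pentagonDiagonal a b c d e j)
    (hsm : s = pentagonDiagonal a b c d e m) :
    IsPentagon ((T.1 ∩ T'.1).erase s) a b c d e := by
  have hcr := segmentsCross_pentagonDiagonal_iff hab hbc hcd hde
  have hedge : ∀ u : Fin n × Fin n, IsEdgeOf T.1 u → (∀ k, u ≠ pentagonDiagonal a b c d e k) →
      IsEdgeOf ((T.1 ∩ T'.1).erase s) u := by
    intro u hu hk
    refine hu.imp_right fun hu => ?_
    rw [Finset.mem_erase, Finset.mem_inter]
    exact ⟨hsm ▸ hk m, hu, h.mem_right hu (hx ▸ hk i)⟩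
  rw [Finset.mem_inter] at hs
  refine ⟨hab, hbc, hcd, hde, hedge _ e₁ ?_, hedge _ e₂ ?_, hedge _ e₃ ?_, hedge _ e₄ ?_,
    hedge _ e₅ ?_, fun u hu => T.2.diagonal u (Finset.mem_inter.mp (Finset.mem_of_mem_erase hu)).1,
    fun u hu v hv => T.2.noncrossing u (Finset.mem_inter.mp (Finset.mem_of_mem_erase hu)).1
      v (Finset.mem_inter.mp (Finset.mem_of_mem_erase hv)).1, ?_, ?_⟩
  iterate 5
    intro k
    fin_cases k <;> simp only [pentagonDiagonal, Fin.reduceFinMk, Matrix.cons_val, ne_eq,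
      Prod.mk.injEq, Fin.ext_iff, Fin.lt_def] at * <;> omega
  · have h₁ := Finset.card_sdiff_add_card_inter T.1 T'.1
    rw [h.sdiff_left, Finset.card_singleton] at h₁
    have h₂ := Finset.card_erase_add_one (Finset.mem_inter.mpr hs)
    have h₃ := T.2.card_add_three
    omega
  · intro k hk
    rw [Finset.mem_erase, Finset.mem_inter, hsm] at hk
    have c₁ := h.cross
    have c₂ := T.2.noncrossing _ hs.1 _ h.left_mem.1
    have c₃ := T'.2.noncrossing _ hs.2 _ h.right_mem.1
    have c₄ := T.2.noncrossing _ hk.2.1 _ h.left_mem.1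
    have c₅ := T'.2.noncrossing _ hk.2.2 _ h.right_mem.1
    have c₆ : k ≠ m := fun e => hk.1 (e ▸ rfl)
    have c₇ : k ≠ i := fun e => h.left_mem.2 (hx ▸ e ▸ hk.2.2)
    have c₈ : k ≠ j := fun e => h.right_mem.2 (hx' ▸ e ▸ hk.2.1)
    rw [hx, hx', hcr] at c₁
    rw [hsm, hx, hcr] at c₂
    rw [hsm, hx', hcr] at c₃
    rw [hx, hcr] at c₄
    rw [hx', hcr] at c₅
    -- Only one pentagon diagonal crosses neither of two crossing ones. Here it is `s`, which has
    -- been erased.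
    have hdec : ∀ i j m k : Fin 5, (j = i + 2 ∨ j = i + 3) → ¬ (i = m + 2 ∨ i = m + 3) →
      ¬ (j = m + 2 ∨ j = m + 3) → ¬ (i = k + 2 ∨ i = k + 3) → ¬ (j = k + 2 ∨ j = k + 3) →
      k = m ∨ k = i ∨ k = j := by decide
    rcases hdec i j m k c₁ c₂ c₃ c₄ c₅ with e | e | e
    exacts [c₆ e, c₇ e, c₈ e]

/-- Removing from the common part of a flip a side of its quadrilateral opens up a pentagon. -/
theorem IsFlip.exists_isPentagon {n : ℕ} (hn : 3 ≤ n) {T T' : PolygonTriangulation n}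
    {d d' s : Fin n × Fin n} (h : IsFlip T T' d d') (hs : s ∈ quadrilateralSides d d')
    (hside : ¬ PolygonSide s) :
    ∃ v₀ v₁ v₂ v₃ v₄, IsPentagon ((T.1 ∩ T'.1).erase s) v₀ v₁ v₂ v₃ v₄ := by
  wlog hlt : d.1 < d'.1 generalizing T T' d d'
  · have := this h.symm (quadrilateralSides_comm d d' ▸ hs) (by
      rcases h.cross with hc | hc
      · exact absurd hc.1 hlt
      · exact hc.1)
    rwa [Finset.inter_comm] at this
  have hc := h.cross
  have hI : ∀ u ∈ quadrilateralSides d d', IsEdgeOf T.1 u := fun u hu =>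
    (h.isEdgeOf_side hn hu).imp_right fun hu => (Finset.mem_inter.mp hu).1
  have hsI : s ∈ T.1 ∩ T'.1 := (h.isEdgeOf_side hn hs).resolve_left hside
  have hsT := (Finset.mem_inter.mp hsI).1
  obtain ⟨p, r⟩ := d
  obtain ⟨q, t⟩ := d'
  obtain ⟨hpq, hqr, hrt⟩ : p < q ∧ q < r ∧ r < t := by
    simp only [SegmentsCross, Fin.lt_def] at *
    omega
  rw [quadrilateralSides_eq hpq hqr hrt] at hs hI
  simp only [Finset.mem_insert, Finset.mem_singleton, forall_eq_or_imp, forall_eq] at hs hI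
  obtain ⟨i₁, i₂, i₃, i₄⟩ := hI
  -- The pentagon is the quadrilateral together with the triangle of `T` beyond `s`: below `s` for
  -- the first three sides, above it for `(p, t)`. The indices `i`, `j`, `m` locate the two flipped
  -- diagonals and `s` in the pentagon.
  rcases hs with rfl | rfl | rfl | rfl
  · obtain ⟨k, k₁, k₂, k₃, k₄⟩ := T.2.exists_inner_apex hn hsT
    exact ⟨_, _, _, _, _, h.isPentagon k₁ k₂ hqr hrt k₃ k₄ i₂ i₃ i₄ hsI
      (i := 1) (j := 4) (m := 0) rfl rfl rfl⟩
  · obtain ⟨k, k₁, k₂, k₃, k₄⟩ := T.2.exists_inner_apex hn hsT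
    exact ⟨_, _, _, _, _, h.isPentagon hpq k₁ k₂ hrt i₁ k₃ k₄ i₃ i₄ hsI
      (i := 1) (j := 3) (m := 2) rfl rfl rfl⟩
  · obtain ⟨k, k₁, k₂, k₃, k₄⟩ := T.2.exists_inner_apex hn hsT
    exact ⟨_, _, _, _, _, h.isPentagon hpq hqr k₁ k₂ i₁ i₂ k₃ k₄ i₄ hsI
      (i := 0) (j := 3) (m := 4) rfl rfl rfl⟩
  · rcases T.2.exists_outer_apex hn hsT with ⟨k, k₁, k₂, k₃⟩ | ⟨k, k₁, k₂, k₃⟩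
    · exact ⟨_, _, _, _, _, h.isPentagon k₁ hpq hqr hrt k₂ i₁ i₂ i₃ k₃ hsI
        (i := 2) (j := 4) (m := 3) rfl rfl rfl⟩
    · exact ⟨_, _, _, _, _, h.isPentagon hpq hqr hrt k₁ i₁ i₂ i₃ k₃ k₂ hsI
        (i := 0) (j := 2) (m := 1) rfl rfl rfl⟩

/-! ### Five-cycles as subgraphs -/

/-- In a triangle-free graph a five-cycle is determined by its vertex set. -/
theorem SimpleGraph.Subgraph.eq_of_verts_eq_of_iso_cycleGraph_five {V : Type*} {G : SimpleGraph V}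
    (hG : ∀ u v w, G.Adj u v → G.Adj u w → ¬ G.Adj v w) {C C' : G.Subgraph}
    (hC : Nonempty (C.coe ≃g SimpleGraph.cycleGraph 5))
    (hC' : Nonempty (C'.coe ≃g SimpleGraph.cycleGraph 5)) (h : C.verts = C'.verts) : C = C' := by
  have key : ∀ D : G.Subgraph, Nonempty (D.coe ≃g SimpleGraph.cycleGraph 5) →
      ∀ u ∈ D.verts, ∀ v ∈ D.verts, G.Adj u v → D.Adj u v := by
    rintro D ⟨f⟩ u hu v hv huv
    by_contra hD
    -- Non-adjacent vertices of a 5-cycle have a common neighbour, so a chord would create a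
    -- triangle. Hence the cycle is induced.
    have hdec : ∀ k l : Fin 5, k ≠ l → ¬ (SimpleGraph.cycleGraph 5).Adj k l →
      ∃ m, (SimpleGraph.cycleGraph 5).Adj m k ∧ (SimpleGraph.cycleGraph 5).Adj m l := by decide
    obtain ⟨m, hm₁, hm₂⟩ := hdec (f ⟨u, hu⟩) (f ⟨v, hv⟩)
      (fun e => huv.ne (congrArg Subtype.val (f.injective e)))
      (fun e => hD (f.map_adj_iff.mp e))
    obtain ⟨w, rfl⟩ := f.surjective m
    exact hG _ _ _ (D.adj_sub (f.map_adj_iff.mp hm₁)) (D.adj_sub (f.map_adj_iff.mp hm₂)) huv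
  refine SimpleGraph.Subgraph.ext h ?_
  ext u v
  exact ⟨fun e => key C' hC' u (h ▸ C.edge_vert e) v (h ▸ C.edge_vert e.symm) (C.adj_sub e),
    fun e => key C hC u (h ▸ C'.edge_vert e) v (h ▸ C'.edge_vert e.symm) (C'.adj_sub e)⟩

theorem SimpleGraph.Subgraph.exists_of_iso_cycleGraph_five {V : Type*} {G : SimpleGraph V}
    {C : G.Subgraph} (hC : Nonempty (C.coe ≃g SimpleGraph.cycleGraph 5)) {u v : V}
    (huv : C.Adj u v) :
    ∃ x y z, G.Adj v x ∧ G.Adj x y ∧ G.Adj y z ∧ G.Adj z u ∧ u ≠ x ∧ v ≠ z ∧ x ≠ z ∧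
      ∀ w ∈ C.verts, w = u ∨ w = v ∨ w = x ∨ w = y ∨ w = z := by
  obtain ⟨f⟩ := hC
  have hdec : ∀ k l : Fin 5, (SimpleGraph.cycleGraph 5).Adj k l → ∃ x y z,
      (SimpleGraph.cycleGraph 5).Adj l x ∧ (SimpleGraph.cycleGraph 5).Adj x y ∧
      (SimpleGraph.cycleGraph 5).Adj y z ∧ (SimpleGraph.cycleGraph 5).Adj z k ∧
      k ≠ x ∧ l ≠ z ∧ x ≠ z ∧ ∀ w, w = k ∨ w = l ∨ w = x ∨ w = y ∨ w = z := by
    intro k l hkl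
    -- The difference `l - k` is `1` or `-1` and gives the direction of travel around the cycle.
    refine ⟨l + (l - k), k - (l - k) - (l - k), k - (l - k), ?_⟩
    revert k l
    decide
  have huv' : C.coe.Adj ⟨u, C.edge_vert huv⟩ ⟨v, C.edge_vert huv.symm⟩ := huv
  obtain ⟨x, y, z, h₁, h₂, h₃, h₄, h₅, h₆, h₇, h₈⟩ := hdec _ _ (f.map_adj_iff.mpr huv')
  obtain ⟨x, rfl⟩ := f.surjective x
  obtain ⟨y, rfl⟩ := f.surjective y
  obtain ⟨z, rfl⟩ := f.surjective z
  refine ⟨x, y, z, C.adj_sub (f.map_adj_iff.mp h₁), C.adj_sub (f.map_adj_iff.mp h₂),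
    C.adj_sub (f.map_adj_iff.mp h₃), C.adj_sub (f.map_adj_iff.mp h₄), ?_, ?_, ?_, ?_⟩
  · rintro rfl; exact h₅ rfl
  · rintro rfl; exact h₆ rfl
  · intro e; exact h₇ (congrArg f (Subtype.ext e))
  · intro w hw
    have := h₈ (f ⟨w, hw⟩)
    simpa only [f.injective.eq_iff, Subtype.ext_iff] using this

theorem SimpleGraph.Subgraph.ncard_verts_of_iso_cycleGraph_five {V : Type*} {G : SimpleGraph V}
    {C : G.Subgraph} (hC : Nonempty (C.coe ≃g SimpleGraph.cycleGraph 5)) : C.verts.ncard = 5 := by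
  obtain ⟨f⟩ := hC
  rw [← Nat.card_coe_set_eq, Nat.card_congr f.toEquiv, Nat.card_fin]

/-! ### Matching five-cycles with sides -/

section Flip

variable {n : ℕ} {T T' : PolygonTriangulation n} {d d' : Fin n × Fin n}

theorem IsFlip.induce_mem_fiveCyclesThrough (hn : 3 ≤ n)
    (hadj : (associahedronGraph n).Adj T T') (h : IsFlip T T' d d') {s : Fin n × Fin n}
    (hs : s ∈ quadrilateralSides d d') (hside : ¬ PolygonSide s) :
    (⊤ : (associahedronGraph n).Subgraph).induce {R | (T.1 ∩ T'.1).erase s ⊆ R.1} ∈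
      fiveCyclesThrough (associahedronGraph n) T T' := by
  obtain ⟨_, _, _, _, _, hP⟩ := h.exists_isPentagon hn hs hside
  exact ⟨hP.nonempty_iso, (Finset.erase_subset _ _).trans Finset.inter_subset_left,
    (Finset.erase_subset _ _).trans Finset.inter_subset_right, hadj⟩

theorem IsFlip.exists_side_verts_eq (hn : 3 ≤ n) (h : IsFlip T T' d d')
    {C : (associahedronGraph n).Subgraph}
    (hC : C ∈ fiveCyclesThrough (associahedronGraph n) T T') :
    ∃ s ∈ quadrilateralSides d d', ¬ PolygonSide s ∧
      C.verts = {R | (T.1 ∩ T'.1).erase s ⊆ R.1} := by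
  obtain ⟨X, Y, Z, h₁, h₂, h₃, h₄, h₅, h₆, h₇, h₈⟩ :=
    SimpleGraph.Subgraph.exists_of_iso_cycleGraph_five hC.1 hC.2
  obtain ⟨s, hs, hside, hsub⟩ := h.exists_side_of_five_cycle hn h₁ h₂ h₃ h₄ h₅ h₆ h₇
  refine ⟨s, hs, hside, ?_⟩
  have hcard := SimpleGraph.Subgraph.ncard_verts_of_iso_cycleGraph_five hC.1
  obtain ⟨_, _, _, _, _, hP⟩ := h.exists_isPentagon hn hs hside
  have hcard' := SimpleGraph.Subgraph.ncard_verts_of_iso_cycleGraph_five hP.nonempty_iso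
  rw [SimpleGraph.Subgraph.induce_verts] at hcard'
  -- One inclusion suffices, because both sets have five elements.
  refine Set.eq_of_subset_of_ncard_le (fun R hR u hu => ?_) (by omega)
    (Set.finite_of_ncard_ne_zero (by omega))
  rw [Finset.mem_erase] at hu
  have hu' := hsub u hu.2 hu.1
  have hu'' := Finset.mem_inter.mp hu.2
  rcases h₈ R hR with rfl | rfl | rfl | rfl | rfl
  exacts [hu''.1, hu''.2, hu'.1, hu'.2.1, hu'.2.2]

/-- If `s ≠ s'`, all five triangulations of the pentagon opened by `s` contain `s`. But those with
indices `0` and `2` have no pentagon diagonal in common. -/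
theorem IsFlip.side_eq_of_setOf_subset_eq (hn : 3 ≤ n) (h : IsFlip T T' d d')
    {s s' : Fin n × Fin n} (hs : s ∈ quadrilateralSides d d') (hside : ¬ PolygonSide s)
    (heq : {R : PolygonTriangulation n | (T.1 ∩ T'.1).erase s ⊆ R.1} =
      {R | (T.1 ∩ T'.1).erase s' ⊆ R.1}) : s = s' := by
  by_contra hne
  obtain ⟨_, _, _, _, _, hP⟩ := h.exists_isPentagon hn hs hside
  have hsI : s ∈ T.1 ∩ T'.1 := (h.isEdgeOf_side hn hs).resolve_left hside
  have hall : ∀ k, s ∈ (hP.triangulation k).1 := fun k => by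
    have : hP.triangulation k ∈ {R : PolygonTriangulation n | (T.1 ∩ T'.1).erase s' ⊆ R.1} :=
      heq ▸ hP.subset_triangulation k
    exact this (Finset.mem_erase.mpr ⟨hne, hsI⟩)
  have hmem : ∀ k : Fin 5, ∃ l ∈ ({k, k + 1} : Finset (Fin 5)), pentagonDiagonal _ _ _ _ _ l = s :=
    fun k => by
      rcases Finset.mem_union.mp (hall k) with hk | hk
      · exact absurd rfl (Finset.mem_erase.mp hk).1
      · exact Finset.mem_image.mp hk
  obtain ⟨l, hl, e⟩ := hmem 0
  obtain ⟨m, hm, e'⟩ := hmem 2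
  have hlm : l = m := hP.injective (e.trans e'.symm)
  subst hlm
  revert l
  have : ∀ l : Fin 5, l ∈ ({0, 0 + 1} : Finset (Fin 5)) → l ∉ ({2, 2 + 1} : Finset (Fin 5)) := by
    decide
  exact fun l hl _ hm _ => this l hl hm

/-- Four polygon sides forming a quadrilateral would make the polygon itself a quadrilateral. -/
theorem exists_not_polygonSide_of_cross (hn : 5 ≤ n) (h : SegmentsCross d d') :
    ∃ s ∈ quadrilateralSides d d', ¬ PolygonSide s := by
  wlog hlt : d.1 < d'.1 generalizing d d'
  · rw [quadrilateralSides_comm]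
    refine this h.symm ?_
    rcases h with hc | hc
    · exact absurd hc.1 hlt
    · exact hc.1
  by_contra! hall
  obtain ⟨p, r⟩ := d
  obtain ⟨q, t⟩ := d'
  obtain ⟨hpq, hqr, hrt⟩ : p < q ∧ q < r ∧ r < t := by
    simp only [SegmentsCross, Fin.lt_def] at *
    omega
  rw [quadrilateralSides_eq hpq hqr hrt] at hall
  simp only [Finset.mem_insert, Finset.mem_singleton, forall_eq_or_imp, forall_eq, PolygonSide,
    Fin.lt_def] at *
  omega

theorem card_quadrilateralSides_le (h : SegmentsCross d d') :
    (quadrilateralSides d d').card ≤ 4 := by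
  rcases h with ⟨h₁, h₂, h₃⟩ | ⟨h₁, h₂, h₃⟩
  · rw [← d.eta, ← d'.eta, quadrilateralSides_eq h₁ h₂ h₃]
    exact Finset.card_le_four
  · rw [quadrilateralSides_comm, ← d.eta, ← d'.eta, quadrilateralSides_eq h₁ h₂ h₃]
    exact Finset.card_le_four

end Flip

theorem proposition3p3 (n : ℕ) (hn : 5 ≤ n) (T T' : PolygonTriangulation n)
    (h : (associahedronGraph n).Adj T T') :
    -- at least one and at most four 5-cycles contain the edge
    (1 ≤ (fiveCyclesThrough (associahedronGraph n) T T').ncard ∧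
      (fiveCyclesThrough (associahedronGraph n) T T').ncard ≤ 4) ∧
    -- the flipped diagonals `d`, `d'` are the diagonals of a quadrilateral
    ∃ d d' : Fin n × Fin n, T.1 \ T'.1 = {d} ∧ T'.1 \ T.1 = {d'} ∧ SegmentsCross d d' ∧
      -- a side of the quadrilateral is not a side of the polygon iff it is a common diagonal
      (∀ s ∈ quadrilateralSides d d', ¬ PolygonSide s ↔ s ∈ T.1 ∩ T'.1) ∧
      -- the 5-cycles through the edge correspond to those sides
      ∃ φ : fiveCyclesThrough (associahedronGraph n) T T' ≃
          {s : Fin n × Fin n // s ∈ quadrilateralSides d d' ∧ ¬ PolygonSide s},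
        ∀ C : fiveCyclesThrough (associahedronGraph n) T T',
          C.1.verts = {R | (T.1 ∩ T'.1).erase (φ C).1 ⊆ R.1} := by
  classical
  have hn₃ : 3 ≤ n := by omega
  obtain ⟨d, d', hf⟩ := exists_isFlip hn₃ h
  let ψ : {s : Fin n × Fin n // s ∈ quadrilateralSides d d' ∧ ¬ PolygonSide s} →
      fiveCyclesThrough (associahedronGraph n) T T' := fun s =>
    ⟨_, hf.induce_mem_fiveCyclesThrough hn₃ h s.2.1 s.2.2⟩
  have hψ : Function.Bijective ψ := by
    constructor
    · intro s s' hss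
      exact Subtype.ext (hf.side_eq_of_setOf_subset_eq hn₃ s.2.1 s.2.2
        (congrArg (fun C => C.1.verts) hss))
    · rintro ⟨C, hC⟩
      obtain ⟨s, hs, hside, hverts⟩ := hf.exists_side_verts_eq hn₃ hC
      refine ⟨⟨s, hs, hside⟩, Subtype.ext ?_⟩
      exact SimpleGraph.Subgraph.eq_of_verts_eq_of_iso_cycleGraph_five
        (fun _ _ _ => associahedronGraph_triangle_free hn₃) (ψ ⟨s, hs, hside⟩).2.1 hC.1 hverts.symm
  let φ := (Equiv.ofBijective ψ hψ).symm
  have hcard : (fiveCyclesThrough (associahedronGraph n) T T').ncard =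
      ((quadrilateralSides d d').filter fun s => ¬ PolygonSide s).card := by
    rw [← Nat.card_coe_set_eq, Nat.card_congr φ]
    exact Nat.subtype_card _ fun s => Finset.mem_filter
  refine ⟨⟨?_, ?_⟩, d, d', hf.sdiff_left, hf.sdiff_right, hf.cross, fun s hs => ?_, φ, fun C => ?_⟩
  · obtain ⟨s, hs, hside⟩ := exists_not_polygonSide_of_cross hn hf.cross
    rw [hcard, Nat.one_le_iff_ne_zero, Finset.card_ne_zero]
    exact ⟨s, Finset.mem_filter.mpr ⟨hs, hside⟩⟩
  · rw [hcard]
    exact (Finset.card_filter_le _ _).trans (card_quadrilateralSides_le hf.cross)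
  · exact ⟨(hf.isEdgeOf_side hn₃ hs).resolve_left, fun hm =>
      (T.2.diagonal _ (Finset.mem_inter.mp hm).1).2⟩
  · exact congrArg (fun C => C.1.verts) ((Equiv.ofBijective ψ hψ).apply_symm_apply C).symm
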